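/- All graphs are finite, simple and labelled. The \emph{core} of a graph is its maximum subgraph with minimum degree at least two (it is empty for trees), and a \emph{2-graph} is a (nonempty) connected graph with minimum degree at least two. Let $\mathcal G$ be a class of graphs, closed under isomorphism, such that a connected graph belongs to $\mathcal G$ if and only if its core is empty or belongs to $\mathcal G$ (in particular every tree belongs to $\mathcal G$). Let $c_n$ and $h_n$ be the numbers of connected graphs and of 2-graphs in $\mathcal G$ with vertex set $\{1,\dots,n\}$, and let $c_{n,k}$, $h_{n,k}$ be the numbers of those with exactly $k$ edges. Put $$C(x)=\sum_n c_n\frac{x^n}{n!},\quad H(x)=\sum_n h_n\frac{x^n}{n!},\quad C(x,y)=\sum_{n,k} c_{n,k}\,y^k\frac{x^n}{n!},\quad H(x,y)=\sum_{n,k} h_{n,k}\,y^k\frac{x^n}{n!},$$ and let $T(z)$ and $U(z)$ be the exponential generating functions of labelled rooted trees and of labelled unrooted trees, counted by vertices. Then, as formal power series, $$C(z)=H(T(z))+U(z),\qquad H(x)=C(xe^{-x})-x+\frac{x^2}{2},\qquad H(x,y)=C(xe^{-xy},y)-x+\frac{x^2y}{2}.$$ Moreover, the class of all graphs and the class of planar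 graphs satisfy the condition on $\mathcal G$, so these identities hold for them. -/

import Mathlib

open scoped Nat

noncomputable section

namespace CoreEnum

/-- Minimum degree at least two (vacuously true for the graph with no vertices). -/
def MinDegTwo {V : Type} (G : SimpleGraph V) : Prop :=
  ∀ v, 2 ≤ (G.neighborSet v).encard

/-- The core of `G`: the maximum subgraph of `G` with minimum degree at least two
(see `core_isGreatest`).  It is `⊥`, the subgraph without vertices, if `G` is a finite tree. -/
def core {V : Type} (G : SimpleGraph V) : G.Subgraph :=
  sSup {K : G.Subgraph | MinDegTwo K.coe}

/-- The core has minimum degree at least two, and contains every subgraph with that property. -/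
theorem core_isGreatest {V : Type} (G : SimpleGraph V) :
    IsGreatest {K : G.Subgraph | MinDegTwo K.coe} (core G) := by
  refine ⟨?_, fun K hK => le_sSup hK⟩
  rintro ⟨v, hv⟩
  have hv' := hv
  simp only [core, SimpleGraph.Subgraph.verts_sSup, Set.mem_iUnion] at hv'
  obtain ⟨K, hK, hvK⟩ := hv'
  have hle : K ≤ core G := le_sSup hK
  refine (hK ⟨v, hvK⟩).trans ?_
  have himg : (fun w : K.verts => (⟨w.1, hle.1 w.2⟩ : (core G).verts)) ''
      (K.coe.neighborSet ⟨v, hvK⟩) ⊆ (core G).coe.neighborSet ⟨v, hv⟩ := by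
    rintro _ ⟨w, hw, rfl⟩
    exact hle.2 hw
  have hinj : Function.Injective
      (fun w : K.verts => (⟨w.1, hle.1 w.2⟩ : (core G).verts)) := by
    intro a b hab
    exact Subtype.ext (congrArg (fun z : (core G).verts => z.1) hab)
  rw [← hinj.encard_image]
  exact Set.encard_le_encard himg

/-- A `2`-graph: a connected graph with minimum degree at least two. -/
def IsTwoGraph {V : Type} (G : SimpleGraph V) : Prop :=
  G.Connected ∧ MinDegTwo G

/-- `G` is planar: it has a drawing in the plane in which distinct vertices are distinct points,
every edge is a simple arc joining its two ends that contains no other vertex, and two distinct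
edges meet only in common ends. -/
def IsPlanar {V : Type} (G : SimpleGraph V) : Prop :=
  ∃ (pos : V → EuclideanSpace ℝ (Fin 2)) (arc : Sym2 V → Set (EuclideanSpace ℝ (Fin 2))),
    Function.Injective pos ∧
    (∀ u v, G.Adj u v →
      ∃ γ : Path (pos u) (pos v), Function.Injective γ ∧ Set.range γ = arc s(u, v)) ∧
    (∀ e ∈ G.edgeSet, ∀ w, pos w ∈ arc e → w ∈ e) ∧
    (∀ e ∈ G.edgeSet, ∀ f ∈ G.edgeSet, e ≠ f →
      ∀ x, x ∈ arc e → x ∈ arc f → ∃ w, w ∈ e ∧ w ∈ f ∧ x = pos w)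

theorem IsPlanar.of_iso {V W : Type} {G : SimpleGraph V} {G' : SimpleGraph W} (i : G ≃g G')
    (h : IsPlanar G) : IsPlanar G' := by
  obtain ⟨pos, arc, hinj, harc, hvert, hcross⟩ := h
  have hmem : ∀ e ∈ G'.edgeSet, Sym2.map i.symm e ∈ G.edgeSet := by
    intro e
    induction e with
    | h a b => intro h; simpa [i.symm.map_adj_iff] using h
  have hback : ∀ (e : Sym2 W) (w : V), w ∈ Sym2.map i.symm e → i w ∈ e := by
    intro e w hw
    obtain ⟨a, ha, rfl⟩ := Sym2.mem_map.1 hw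
    simpa using ha
  refine ⟨fun w => pos (i.symm w), fun e => arc (Sym2.map i.symm e),
    hinj.comp i.symm.injective, ?_, ?_, ?_⟩
  · intro u v huv
    simpa using harc _ _ (i.symm.map_adj_iff.2 huv)
  · intro e he w hw
    simpa using hback e _ (hvert _ (hmem e he) _ hw)
  · intro e he f hf hef x hxe hxf
    obtain ⟨w, h1, h2, h3⟩ := hcross _ (hmem e he) _ (hmem f hf)
      (fun h => hef (Sym2.map.injective i.symm.injective h)) x hxe hxf
    exact ⟨i w, hback e w h1, hback f w h2, by simpa using h3⟩

/-- A class of graphs, closed under isomorphism. -/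
structure GraphClass where
  /-- Membership in the class. -/
  Mem : ∀ {V : Type}, SimpleGraph V → Prop
  /-- Invariance under isomorphism. -/
  mem_of_iso : ∀ {V W : Type} {G : SimpleGraph V} {G' : SimpleGraph W},
    (G ≃g G') → Mem G → Mem G'

/-- The class of all graphs. -/
def GraphClass.all : GraphClass where
  Mem _ := True
  mem_of_iso _ h := h

/-- The class of planar graphs. -/
def GraphClass.planar : GraphClass where
  Mem G := IsPlanar G
  mem_of_iso i h := IsPlanar.of_iso i h

/-- A connected finite graph belongs to the class if and only if its core does, where a graph
with empty core (a tree) always belongs to the class. -/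
def GraphClass.CoreClosed (𝒢 : GraphClass) : Prop :=
  ∀ {V : Type} [Finite V] (G : SimpleGraph V), G.Connected →
    (𝒢.Mem G ↔ core G = ⊥ ∨ 𝒢.Mem (core G).coe)

/-- Exponential generating function of a sequence. -/
def egf (a : ℕ → ℕ) : PowerSeries ℚ :=
  PowerSeries.mk fun n => (a n : ℚ) / n !

/-- Bivariate generating function `∑ a n k * y ^ k * x ^ n / n!`, exponential in the
variable `x = X 0` and ordinary in the variable `y = X 1`. -/
def egf₂ (a : ℕ → ℕ → ℕ) : MvPowerSeries (Fin 2) ℚ :=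
  fun m => (a (m 0) (m 1) : ℚ) / (m 0)!

/-- `C(x)`: connected labelled graphs in the class, by number of vertices. -/
def GraphClass.C (𝒢 : GraphClass) : PowerSeries ℚ :=
  egf fun n => Nat.card {G : SimpleGraph (Fin n) // 𝒢.Mem G ∧ G.Connected}

/-- `H(x)`: labelled `2`-graphs in the class, by number of vertices. -/
def GraphClass.H (𝒢 : GraphClass) : PowerSeries ℚ :=
  egf fun n => Nat.card {G : SimpleGraph (Fin n) // 𝒢.Mem G ∧ IsTwoGraph G}

/-- `C(x, y)`: connected labelled graphs in the class, by numbers of vertices and edges. -/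
def GraphClass.C₂ (𝒢 : GraphClass) : MvPowerSeries (Fin 2) ℚ :=
  egf₂ fun n k => Nat.card
    {G : SimpleGraph (Fin n) // 𝒢.Mem G ∧ G.Connected ∧ G.edgeSet.ncard = k}

/-- `H(x, y)`: labelled `2`-graphs in the class, by numbers of vertices and edges. -/
def GraphClass.H₂ (𝒢 : GraphClass) : MvPowerSeries (Fin 2) ℚ :=
  egf₂ fun n k => Nat.card
    {G : SimpleGraph (Fin n) // 𝒢.Mem G ∧ IsTwoGraph G ∧ G.edgeSet.ncard = k}

/-- `T(x)`: labelled rooted trees, by number of vertices. -/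
def rootedTrees : PowerSeries ℚ :=
  egf fun n => Nat.card {p : SimpleGraph (Fin n) × Fin n // p.1.IsTree}

/-- `U(x)`: labelled unrooted trees, by number of vertices. -/
def unrootedTrees : PowerSeries ℚ :=
  egf fun n => Nat.card {G : SimpleGraph (Fin n) // G.IsTree}

/-- The power series `x * exp (-x)`. -/
def xExpNeg : PowerSeries ℚ :=
  PowerSeries.X * (PowerSeries.exp ℚ).subst (-PowerSeries.X : PowerSeries ℚ)

/-- The power series `x * exp (-x * y)`. -/
def xExpNegXY : MvPowerSeries (Fin 2) ℚ :=
  MvPowerSeries.X 0 * (PowerSeries.exp ℚ).subst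
    (-(MvPowerSeries.X 0 * MvPowerSeries.X 1) : MvPowerSeries (Fin 2) ℚ)

/-! The substitutions used are legitimate: all inner series have constant coefficient zero. -/

theorem hasSubst_rootedTrees : PowerSeries.HasSubst rootedTrees := by
  refine PowerSeries.HasSubst.of_constantCoeff_zero' ?_
  simp [rootedTrees, egf, ← PowerSeries.coeff_zero_eq_constantCoeff_apply]

theorem hasSubst_xExpNeg : PowerSeries.HasSubst xExpNeg :=
  PowerSeries.HasSubst.of_constantCoeff_zero' (by simp [xExpNeg])

theorem hasSubst_xExpNegXY :
    MvPowerSeries.HasSubst ![xExpNegXY, (MvPowerSeries.X 1 : MvPowerSeries (Fin 2) ℚ)] := by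
  refine MvPowerSeries.hasSubst_of_constantCoeff_zero fun s => ?_
  fin_cases s <;> simp [xExpNegXY]

theorem hasSubst_negXY : PowerSeries.HasSubst
    (-(MvPowerSeries.X 0 * MvPowerSeries.X 1) : MvPowerSeries (Fin 2) ℚ) :=
  PowerSeries.HasSubst.of_constantCoeff_zero (by simp)

theorem hasSubst_negX : PowerSeries.HasSubst (-PowerSeries.X : PowerSeries ℚ) :=
  PowerSeries.HasSubst.of_constantCoeff_zero' (by simp)

end CoreEnum

end

/-! Everything rests on inclusion-exclusion over leaves. Call a set `S` of vertices of a connected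
graph a leaf set if each vertex of `S` is a leaf whose neighbour lies outside `S`. On three or more
vertices no two leaves are adjacent, so the leaf sets are all subsets of the set of leaves, and `∑
(-1)^|S|` is 1 for a 2-graph and 0 otherwise. The connected graphs on one and two vertices give 1
and -1 instead, whence the terms `-x + x²/2` (`sum_isLeafSet`).

Removing a leaf set of size `j` leaves a connected graph on `n - j` vertices and a map from `S` to
them; membership in the class survives because the core is unchanged (`core_attachLeaves`). So, up
to the correction, `h_n` is `∑ (n choose j) (-1)^j c_{n-j} (n-j)^j`, which is `n!` times the
coefficient of `x^n` in `C(x e^{-x})`. Each leaf brings one edge, hence `xy` in the bivariate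
exponent. `LeafFamily` lets one count serve both versions and also trees.

No tree is a 2-graph, so `U(x e^{-x}) = x - x²/2`; differentiating, with `T = z U'`, gives `T(x
e^{-x}) = x`. Substituting `x e^{-x}` is injective and turns `C = H(T) + U` into the formula for
`H`, so no decomposition of graphs into core and rooted trees is needed.

For planar graphs, the point is to restore a pendant edge: the edges at a vertex are straightened
inside a small disc, which frees a direction for the new edge (`IsPlanar.sup_edge`). -/

noncomputable section

namespace CoreEnum

/-! ### Attaching leaves: connectedness, edges and core -/

/-- The graph obtained from `G` by attaching, for every `b : B`, a new leaf to the vertex `f b`. -/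
def attachLeaves {A B : Type} (G : SimpleGraph A) (f : B → A) : SimpleGraph (A ⊕ B) where
  Adj
    | .inl a, .inl a' => G.Adj a a'
    | .inl a, .inr b => f b = a
    | .inr b, .inl a => f b = a
    | .inr _, .inr _ => False
  symm := ⟨by
    rintro (a | b) (a' | b') h
    exacts [SimpleGraph.Adj.symm (G := G) h, h, h, h]⟩
  loopless := ⟨by
    rintro (a | b) h
    exacts [G.loopless.irrefl a h, h]⟩

section attachLeaves

variable {A B : Type} (G : SimpleGraph A) (f : B → A)

@[simp] theorem attachLeaves_inl_inl {a a' : A} :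
    (attachLeaves G f).Adj (.inl a) (.inl a') ↔ G.Adj a a' := Iff.rfl

@[simp] theorem attachLeaves_inl_inr {a : A} {b : B} :
    (attachLeaves G f).Adj (.inl a) (.inr b) ↔ f b = a := Iff.rfl

@[simp] theorem attachLeaves_inr_inl {a : A} {b : B} :
    (attachLeaves G f).Adj (.inr b) (.inl a) ↔ f b = a := Iff.rfl

@[simp] theorem attachLeaves_inr_inr {b b' : B} :
    ¬ (attachLeaves G f).Adj (.inr b) (.inr b') := id

/-- The inclusion of `G` into the graph with leaves attached. -/
def attachLeavesEmbedding : G ↪g attachLeaves G f where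
  toFun := Sum.inl
  inj' := Sum.inl_injective
  map_rel_iff' := Iff.rfl

/-- Sending each leaf to its neighbour is a retraction onto `G` that collapses the new edges, so
reachability passes down to `G`. -/
theorem attachLeaves_connected_iff : (attachLeaves G f).Connected ↔ G.Connected := by
  have hretract : ∀ x y, (attachLeaves G f).Reachable x y →
      G.Reachable (Sum.elim id f x) (Sum.elim id f y) := by
    rintro x y ⟨p⟩
    induction p with
    | nil => rfl
    | @cons u v w h _ ih =>
      refine SimpleGraph.Reachable.trans ?_ ih
      rcases u with a | b <;> rcases v with a' | b'
      · exact SimpleGraph.Adj.reachable h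
      · rw [attachLeaves_inl_inr] at h; simp [h]
      · rw [attachLeaves_inr_inl] at h; simp [h]
      · exact absurd h (attachLeaves_inr_inr G f)
  constructor
  · intro h
    have hne : Nonempty A := by
      obtain ⟨a | b⟩ := h.nonempty
      exacts [⟨a⟩, ⟨f b⟩]
    exact ⟨fun a a' => hretract _ _ (h.preconnected (.inl a) (.inl a'))⟩
  · intro h
    have hinl : ∀ a a', (attachLeaves G f).Reachable (.inl a) (.inl a') := fun a a' =>
      (h.preconnected a a').map (attachLeavesEmbedding G f).toHom
    have hto : ∀ x, (attachLeaves G f).Reachable x (.inl (Sum.elim id f x)) := by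
      rintro (a | b)
      · rfl
      · exact SimpleGraph.Adj.reachable (by simp)
    obtain ⟨a⟩ := h.nonempty
    have : Nonempty (A ⊕ B) := ⟨.inl a⟩
    exact ⟨fun x y => (hto x).trans ((hinl _ _).trans (hto y).symm)⟩

theorem ncard_edgeSet_attachLeaves [Finite A] [Finite B] :
    (attachLeaves G f).edgeSet.ncard = G.edgeSet.ncard + Nat.card B := by
  have h : (attachLeaves G f).edgeSet =
      Sym2.map Sum.inl '' G.edgeSet ∪ Set.range fun b => s(Sum.inl (f b), Sum.inr b) := by
    ext e
    induction e with | h x y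
    simp only [SimpleGraph.mem_edgeSet, Set.mem_union, Set.mem_image, Set.mem_range]
    constructor
    · rcases x with a | b <;> rcases y with a' | b' <;> intro h
      · exact .inl ⟨s(a, a'), h, rfl⟩
      · exact .inr ⟨b', by rw [show f b' = a from h]⟩
      · exact .inr ⟨b, by rw [show f b = a' from h]; exact Sym2.eq_swap⟩
      · exact h.elim
    · rintro (⟨e, he, h⟩ | ⟨b, h⟩)
      · induction e with | h a a'
        rw [Sym2.map_mk] at h
        rw [← SimpleGraph.mem_edgeSet, ← h]
        exact he
      · rw [← SimpleGraph.mem_edgeSet, ← h]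
        simp
  rw [h, Set.ncard_union_eq, Set.ncard_image_of_injective _ (Sym2.map.injective Sum.inl_injective),
    Set.ncard_range_of_injective]
  · intro b b' hb
    exact (by simpa using hb : f b = f b' ∧ b = b').2
  · rw [Set.disjoint_left]
    rintro _ ⟨e, -, rfl⟩ ⟨b, hb⟩
    have : Sum.inr b ∈ Sym2.map (Sum.inl : A → A ⊕ B) e := hb ▸ Sym2.mem_mk_right _ _
    simp [Sym2.mem_map] at this

theorem not_mem_core_attachLeaves (b : B) : Sum.inr b ∉ (core (attachLeaves G f)).verts := by
  intro hb
  have h := (core_isGreatest (attachLeaves G f)).1 ⟨_, hb⟩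
  refine absurd h (not_le.2 (lt_of_le_of_lt (Set.encard_le_one_iff.2 ?_) (by norm_num)))
  have key : ∀ x : (core (attachLeaves G f)).verts,
      (core (attachLeaves G f)).coe.Adj ⟨_, hb⟩ x → x.1 = .inl (f b) := by
    rintro ⟨x, hx⟩ hbx
    have := (core (attachLeaves G f)).adj_sub hbx
    rcases x with a | b'
    · rw [show f b = a from this]
    · exact this.elim
  intro x y hx hy
  exact Subtype.ext ((key x hx).trans (key y hy).symm)

end attachLeaves

theorem MinDegTwo.of_iso {V W : Type} {G : SimpleGraph V} {G' : SimpleGraph W} (i : G ≃g G')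
    (h : MinDegTwo G) : MinDegTwo G' := by
  intro w
  refine (h (i.symm w)).trans ?_
  rw [← i.injective.encard_image]
  refine Set.encard_le_encard ?_
  rintro _ ⟨u, hu, rfl⟩
  have := i.map_adj_iff.2 hu
  simpa using this

/-- An injective homomorphism maps a subgraph isomorphically. -/
def subgraphMapIso {V W : Type} {G : SimpleGraph V} {G' : SimpleGraph W} (ψ : G →g G')
    (hψ : Function.Injective ψ) (K : G.Subgraph) : K.coe ≃g (K.map ψ).coe where
  toEquiv := Equiv.Set.image ψ K.verts hψ
  map_rel_iff' := by
    rintro ⟨a, ha⟩ ⟨b, hb⟩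
    change (Relation.Map K.Adj ψ ψ) (ψ a) (ψ b) ↔ K.Adj a b
    constructor
    · rintro ⟨a', b', h, ha', hb'⟩
      rwa [← hψ ha', ← hψ hb']
    · exact fun h => ⟨a, b, h, rfl, rfl⟩

/-- The core avoids the new leaves, so it is the image of its own preimage, a subgraph of `G` with
minimum degree two. Conversely, the image of `core G` keeps its degrees. -/
theorem core_attachLeaves {A B : Type} (G : SimpleGraph A) (f : B → A) :
    core (attachLeaves G f) = (core G).map (attachLeavesEmbedding G f).toHom := by
  set ψ := (attachLeavesEmbedding G f).toHom
  have hψ : Function.Injective ψ := Sum.inl_injective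
  apply le_antisymm
  · have hmap : ((core (attachLeaves G f)).comap ψ).map ψ = core (attachLeaves G f) := by
      apply le_antisymm ((SimpleGraph.Subgraph.map_le_iff_le_comap _ _ _).2 le_rfl)
      refine ⟨?_, ?_⟩
      · rintro (a | b) h
        · exact ⟨a, h, rfl⟩
        · exact absurd h (not_mem_core_attachLeaves G f b)
      · rintro (a | b) (a' | b') h
        · exact ⟨a, a', ⟨(core (attachLeaves G f)).adj_sub h, h⟩, rfl, rfl⟩
        · exact absurd h.snd_mem (not_mem_core_attachLeaves G f b')
        · exact absurd h.fst_mem (not_mem_core_attachLeaves G f b)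
        · exact absurd h.fst_mem (not_mem_core_attachLeaves G f b)
    rw [← hmap]
    refine SimpleGraph.Subgraph.map_mono ((core_isGreatest G).2 ?_)
    refine MinDegTwo.of_iso (subgraphMapIso ψ hψ _).symm ?_
    rw [hmap]
    exact (core_isGreatest _).1
  · exact (core_isGreatest _).2 (MinDegTwo.of_iso (subgraphMapIso ψ hψ _) (core_isGreatest G).1)

theorem GraphClass.CoreClosed.mem_attachLeaves_iff {𝒢 : GraphClass} (h𝒢 : 𝒢.CoreClosed)
    {A B : Type} [Finite A] [Finite B] {G : SimpleGraph A} (hG : G.Connected) (f : B → A) :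
    𝒢.Mem (attachLeaves G f) ↔ 𝒢.Mem G := by
  rw [h𝒢 _ hG, h𝒢 _ ((attachLeaves_connected_iff G f).2 hG), core_attachLeaves]
  have i := subgraphMapIso (attachLeavesEmbedding G f).toHom Sum.inl_injective (core G)
  refine or_congr ?_ ⟨𝒢.mem_of_iso i.symm, 𝒢.mem_of_iso i⟩
  constructor <;> intro h
  · have := congrArg SimpleGraph.Subgraph.verts h
    ext a b
    · simp only [SimpleGraph.Subgraph.map_verts, SimpleGraph.Subgraph.verts_bot,
        Set.image_eq_empty] at this
      simp [this]
    · constructor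
      · intro hab
        simp only [SimpleGraph.Subgraph.map_verts, SimpleGraph.Subgraph.verts_bot,
          Set.image_eq_empty] at this
        exact absurd hab.fst_mem (by simp [this])
      · exact fun hab => hab.elim
  · rw [h]
    exact le_bot_iff.1 ((SimpleGraph.Subgraph.map_le_iff_le_comap _ _ _).2 bot_le)

/-! ### Counting connected graphs with a marked leaf set -/

/-- A graph in which the vertices in `B` are leaves with neighbours in `A` is the same thing as
a graph on `A` together with a function from `B` to `A`. -/
def attachLeavesEquiv (A B : Type) : SimpleGraph A × (B → A) ≃
    {G : SimpleGraph (A ⊕ B) // ∀ b, ∃ a, ∀ u, G.Adj (.inr b) u ↔ u = .inl a} where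
  toFun p := ⟨attachLeaves p.1 p.2, fun b => ⟨p.2 b, by
    rintro (a | b')
    · simpa using eq_comm
    · simp⟩⟩
  invFun G := (G.1.comap Sum.inl, fun b => (G.2 b).choose)
  left_inv := by
    rintro ⟨G, f⟩
    refine Prod.ext rfl (funext fun b => ?_)
    have h : ∃ a, ∀ u, (attachLeaves G f).Adj (.inr b) u ↔ u = .inl a := ⟨f b, by
      rintro (a | b')
      · simpa using eq_comm
      · simp⟩
    change h.choose = f b
    have := (h.choose_spec (.inl (f b))).1 rfl
    exact (Sum.inl_injective this).symm
  right_inv := by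
    rintro ⟨G, hG⟩
    have key : ∀ a b, G.Adj (.inr b) (.inl a) ↔ (hG b).choose = a := fun a b =>
      ((hG b).choose_spec (.inl a)).trans (by simpa using eq_comm)
    apply Subtype.ext
    ext (a | b) (a' | b')
    · rfl
    · exact (key a b').symm.trans (G.adj_comm _ _)
    · exact (key a' b).symm
    · have := (hG b).choose_spec (.inr b')
      simp [this]

/-- Every vertex in `S` is a leaf whose neighbour is outside `S`. -/
def IsLeafSet {V : Type} (G : SimpleGraph V) (S : Set V) : Prop :=
  ∀ v ∈ S, ∃ w ∉ S, ∀ u, G.Adj v u ↔ u = w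

/-- A family of isomorphism invariant graph properties, indexed by a number of leaves still to be
attached, that is compatible with attaching leaves to connected graphs. -/
structure LeafFamily where
  /-- The property that is expected of a graph to which `j` leaves will be attached. -/
  Mem : ℕ → ∀ {V : Type}, SimpleGraph V → Prop
  mem_of_iso : ∀ {j : ℕ} {V W : Type} {G : SimpleGraph V} {G' : SimpleGraph W},
    (G ≃g G') → Mem j G → Mem j G'
  mem_attachLeaves_iff : ∀ {j : ℕ} {A B : Type} [Finite A] [Finite B] {G : SimpleGraph A}
    (f : B → A), G.Connected → (Mem j (attachLeaves G f) ↔ Mem (j + Nat.card B) G)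

/-- The number of connected graphs on `n` vertices to which `j` leaves may be attached. -/
def LeafFamily.c (Q : LeafFamily) (n j : ℕ) : ℕ :=
  Nat.card {G : SimpleGraph (Fin n) // Q.Mem j G ∧ G.Connected}

theorem card_isLeafSet_range (Q : LeafFamily) {A B V : Type} [Finite A] [Finite B]
    (e : A ⊕ B ≃ V) (j : ℕ) :
    Nat.card {G : SimpleGraph V //
      (Q.Mem j G ∧ G.Connected) ∧ IsLeafSet G (Set.range (e ∘ Sum.inr))} =
    Nat.card {G : SimpleGraph A // Q.Mem (j + Nat.card B) G ∧ G.Connected} *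
      Nat.card (B → A) := by
  rw [← Nat.card_prod]
  refine Nat.card_congr (Equiv.trans ?_
    (Equiv.prodSubtypeFstEquivSubtypeProd
      (p := fun G : SimpleGraph A => Q.Mem (j + Nat.card B) G ∧ G.Connected)))
  refine Equiv.symm (((attachLeavesEquiv A B).subtypeEquiv
    (q := fun G => Q.Mem j G.1 ∧ G.1.Connected) ?_).trans
      ((Equiv.subtypeSubtypeEquivSubtypeInter _
        (fun G : SimpleGraph (A ⊕ B) => Q.Mem j G ∧ G.Connected)).trans
        (e.simpleGraph.subtypeEquiv ?_)))
  · rintro ⟨G, f⟩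
    change _ ↔ Q.Mem j (attachLeaves G f) ∧ (attachLeaves G f).Connected
    rw [attachLeaves_connected_iff]
    exact and_congr_left fun h => (Q.mem_attachLeaves_iff f h).symm
  · intro G
    have i : e.simpleGraph G ≃g G := SimpleGraph.Iso.comap e.symm G
    have hadj : ∀ x y, (e.simpleGraph G).Adj x y ↔ G.Adj (e.symm x) (e.symm y) :=
      fun x y => Iff.rfl
    rw [and_comm]
    refine and_congr (and_congr ⟨Q.mem_of_iso i.symm, Q.mem_of_iso i⟩ i.connected_iff.symm) ?_
    constructor
    · rintro h _ ⟨b, rfl⟩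
      obtain ⟨a, ha⟩ := h b
      refine ⟨e (.inl a), by simp, fun u => ?_⟩
      rw [hadj]
      simp [ha, e.symm_apply_eq]
    · intro h b
      obtain ⟨w, hw, hu⟩ := h _ ⟨b, rfl⟩
      obtain ⟨x, rfl⟩ := e.surjective w
      rcases x with a | b'
      · refine ⟨a, fun u => ?_⟩
        have := hu (e u)
        rw [hadj] at this
        simpa using this
      · exact absurd ⟨b', rfl⟩ hw

/-- The count depends on `S` only through its size: delete `S`, relabel the rest, and record the
neighbour of each deleted leaf. -/
theorem card_isLeafSet (Q : LeafFamily) {n : ℕ} (S : Finset (Fin n)) :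
    Nat.card {G : SimpleGraph (Fin n) // (Q.Mem 0 G ∧ G.Connected) ∧ IsLeafSet G S} =
    Q.c (n - S.card) S.card * (n - S.card) ^ S.card := by
  have h1 : Sᶜ.card = n - S.card := by rw [Finset.card_compl, Fintype.card_fin]
  have h2 : Sᶜᶜ.card = S.card := by rw [compl_compl]
  have h := card_isLeafSet_range Q (finSumEquivOfFinset h1 h2) 0
  have hS : Set.range (finSumEquivOfFinset h1 h2 ∘ Sum.inr) = (S : Set (Fin n)) := by
    have : finSumEquivOfFinset h1 h2 ∘ Sum.inr = Sᶜᶜ.orderEmbOfFin h2 := by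
      ext i
      simp
    rw [this, Finset.range_orderEmbOfFin, compl_compl]
  rw [hS] at h
  simpa [LeafFamily.c] using h

/-! ### Inclusion-exclusion over leaf sets -/

theorem IsTwoGraph.three_le {n : ℕ} {G : SimpleGraph (Fin n)} (h : IsTwoGraph G) : 3 ≤ n := by
  obtain ⟨v⟩ := h.1.nonempty
  have h3 : (insert v (G.neighborSet v)).encard ≤ n := by
    refine (Set.encard_le_encard (Set.subset_univ _)).trans ?_
    simp
  rw [Set.encard_insert_of_notMem (by simp)] at h3
  have := (add_le_add_left (h.2 v) 1).trans h3
  exact_mod_cast this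

open Classical in
theorem sum_isLeafSet {n : ℕ} (G : SimpleGraph (Fin n)) (hG : G.Connected) :
    (∑ S : Finset (Fin n), if IsLeafSet G S then (-1 : ℤ) ^ S.card else 0) =
      (if IsTwoGraph G then 1 else 0) + (if n = 1 then 1 else 0) - (if n = 2 then 1 else 0) := by
  rw [← Finset.sum_filter]
  have hpos : 0 < n := by
    obtain ⟨v⟩ := hG.nonempty
    exact v.pos
  have hdeg : n ≤ 2 → ¬ IsTwoGraph G := fun hn h => absurd h.three_le (by omega)
  rcases (by omega : n = 1 ∨ n = 2 ∨ 3 ≤ n) with rfl | rfl | hn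
  · rw [if_neg (hdeg (by norm_num))]
    have : (Finset.univ : Finset (Finset (Fin 1))).filter
        (fun S : Finset (Fin 1) => IsLeafSet G S) = {∅} := by
      ext S
      simp only [Finset.mem_filter, Finset.mem_univ, true_and, Finset.mem_singleton]
      constructor
      · intro h
        by_contra hS
        obtain ⟨v, hv⟩ := Finset.nonempty_iff_ne_empty.2 hS
        obtain ⟨w, hw, -⟩ := h v hv
        exact hw (by rwa [Subsingleton.elim w v])
      · rintro rfl v hv
        simp at hv
    simp [this]
  · rw [if_neg (hdeg le_rfl)]
    have hG2 : G = ⊤ := by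
      obtain ⟨w, hw⟩ := hG.preconnected.exists_adj_of_nontrivial (0 : Fin 2)
      have h01 : G.Adj 0 1 := by
        fin_cases w
        · exact absurd hw (by simp)
        · exact hw
      ext a b
      fin_cases a <;> fin_cases b <;> simp [h01, h01.symm]
    subst hG2
    have : (Finset.univ : Finset (Finset (Fin 2))).filter
        (fun S : Finset (Fin 2) => IsLeafSet (⊤ : SimpleGraph (Fin 2)) S) = {∅, {0}, {1}} := by
      ext S
      simp only [IsLeafSet, Finset.mem_coe, SimpleGraph.top_adj, Finset.mem_filter,
        Finset.mem_univ, true_and]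
      revert S
      decide
    rw [this, Finset.sum_insert (by decide), Finset.sum_insert (by decide)]
    simp
  · have hnt : Nontrivial (Fin n) := Fin.nontrivial_iff_two_le.2 (by omega)
    let L : Finset (Fin n) := Finset.univ.filter fun v => ∃ w, ∀ u, G.Adj v u ↔ u = w
    have hfilter : (Finset.univ : Finset (Finset (Fin n))).filter
        (fun S : Finset (Fin n) => IsLeafSet G S) = L.powerset := by
      ext S
      simp only [Finset.mem_filter, Finset.mem_univ, true_and, Finset.mem_powerset]
      constructor
      · intro h v hv
        obtain ⟨w, -, hw⟩ := h v hv
        exact Finset.mem_filter.2 ⟨Finset.mem_univ _, w, hw⟩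
      · intro h v hv
        obtain ⟨-, w, hw⟩ := Finset.mem_filter.1 (h hv)
        -- Two adjacent leaves form a whole component, so the connected graph would have only two
        -- vertices.
        refine ⟨w, fun hwS => ?_, hw⟩
        obtain ⟨-, v', hv'⟩ := Finset.mem_filter.1 (h hwS)
        have hvv' : v = v' := (hv' v).1 ((hw w).2 rfl).symm
        subst hvv'
        have hall : ∀ x y, G.Reachable x y → x = v ∨ x = w → y = v ∨ y = w := by
          rintro x y ⟨p⟩
          induction p with
          | nil => exact id
          | cons hxy _ ih =>
            rintro (rfl | rfl)
            · exact ih (.inr ((hw _).1 hxy))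
            · exact ih (.inl ((hv' _).1 hxy))
        have huniv : (Finset.univ : Finset (Fin n)) ⊆ {v, w} := by
          intro y _
          simpa using hall v y (hG.preconnected v y) (.inl rfl)
        have := (Finset.card_le_card huniv).trans Finset.card_le_two
        simp at this
        omega
    have htwo : IsTwoGraph G ↔ L = ∅ := by
      constructor
      · rintro ⟨-, h⟩
        rw [Finset.filter_eq_empty_iff]
        rintro v - ⟨w, hw⟩
        have : G.neighborSet v = {w} := by
          ext u
          exact hw u
        have h2 := h v
        rw [this, Set.encard_singleton] at h2
        exact absurd h2 (by decide)
      · intro h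
        refine ⟨hG, fun v => ?_⟩
        obtain ⟨w, hw⟩ := hG.preconnected.exists_adj_of_nontrivial v
        by_contra hv
        have hle : (G.neighborSet v).encard ≤ 1 := (ENat.lt_add_one_iff (by simp)).1
          (by simpa [one_add_one_eq_two] using hv)
        have : v ∈ L := Finset.mem_filter.2 ⟨Finset.mem_univ _, w, fun u =>
          ⟨fun hu => Set.encard_le_one_iff.1 hle u w hu hw, fun hu => hu ▸ hw⟩⟩
        simp [h] at this
    rw [hfilter, Finset.sum_powerset_neg_one_pow_card, if_neg (by omega : n ≠ 1),
      if_neg (by omega : n ≠ 2)]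
    simp [htwo]

open Classical in
/-- Inclusion-exclusion over the sets of leaves of connected graphs. -/
theorem LeafFamily.card_isTwoGraph (Q : LeafFamily) (n : ℕ) :
    (Nat.card {G : SimpleGraph (Fin n) // Q.Mem 0 G ∧ IsTwoGraph G} : ℤ) +
      (if n = 1 then (Q.c n 0 : ℤ) else 0) - (if n = 2 then (Q.c n 0 : ℤ) else 0) =
    ∑ j ∈ Finset.range (n + 1),
      (n.choose j : ℤ) * ((-1) ^ j * (Q.c (n - j) j * ((n - j : ℕ) : ℤ) ^ j)) := by
  have hcard : ∀ p : SimpleGraph (Fin n) → Prop,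
      (Nat.card {G // p G} : ℤ) = ∑ G : SimpleGraph (Fin n), if p G then 1 else 0 := by
    intro p
    rw [Nat.card_eq_fintype_card, Fintype.card_subtype, Finset.sum_boole]
  have hsum : ∑ S : Finset (Fin n), (-1 : ℤ) ^ S.card *
      (Nat.card {G : SimpleGraph (Fin n) // (Q.Mem 0 G ∧ G.Connected) ∧ IsLeafSet G S} : ℤ) =
      ∑ j ∈ Finset.range (n + 1),
        (n.choose j : ℤ) * ((-1) ^ j * (Q.c (n - j) j * ((n - j : ℕ) : ℤ) ^ j)) := by
    have := Finset.sum_powerset_apply_card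
      (fun j => (-1 : ℤ) ^ j * (Q.c (n - j) j * ((n - j : ℕ) : ℤ) ^ j))
      (x := (Finset.univ : Finset (Fin n)))
    rw [Finset.powerset_univ, Finset.card_univ, Fintype.card_fin] at this
    simp only [nsmul_eq_mul] at this
    rw [← this]
    refine Finset.sum_congr rfl fun S _ => ?_
    rw [card_isLeafSet]
    push_cast
    rfl
  rw [← hsum]
  simp only [hcard, Finset.mul_sum]
  rw [Finset.sum_comm (s := (Finset.univ : Finset (Finset (Fin n))))]
  have key : ∀ G : SimpleGraph (Fin n),
      (∑ S : Finset (Fin n), (-1 : ℤ) ^ S.card *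
        (if (Q.Mem 0 G ∧ G.Connected) ∧ IsLeafSet G S then 1 else 0)) =
      (if Q.Mem 0 G ∧ IsTwoGraph G then 1 else 0) +
        (if n = 1 then (if Q.Mem 0 G ∧ G.Connected then 1 else 0) else 0) -
        (if n = 2 then (if Q.Mem 0 G ∧ G.Connected then 1 else 0) else 0) := by
    intro G
    by_cases h : Q.Mem 0 G ∧ G.Connected
    · simp only [h, and_self, true_and, mul_ite, mul_one, mul_zero, if_true]
      exact sum_isLeafSet G h.2
    · have h' : ¬ (Q.Mem 0 G ∧ IsTwoGraph G) := fun h' => h ⟨h'.1, h'.2.1⟩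
      simp [h, h']
  refine Eq.trans ?_ (Finset.sum_congr rfl fun G _ => (key G).symm.trans (by congr!))
  simp only [Finset.sum_sub_distrib, Finset.sum_add_distrib]
  congr 2
  · congr!
  · split_ifs with h
    · rw [LeafFamily.c, hcard]
      congr!
    · simp
  · split_ifs with h
    · rw [LeafFamily.c, hcard]
      congr!
    · simp

theorem LeafFamily.c_one (Q : LeafFamily) {j : ℕ} (h : Q.Mem j (⊥ : SimpleGraph (Fin 1))) :
    Q.c 1 j = 1 := by
  rw [LeafFamily.c, Nat.card_eq_one_iff_unique]
  exact ⟨inferInstance, ⟨⟨⊥, h, SimpleGraph.Connected.of_subsingleton⟩⟩⟩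

theorem LeafFamily.c_one_of_not (Q : LeafFamily) {j : ℕ}
    (h : ¬ Q.Mem j (⊥ : SimpleGraph (Fin 1))) : Q.c 1 j = 0 := by
  rw [LeafFamily.c, Nat.card_eq_zero]
  refine .inl ⟨?_⟩
  rintro ⟨G, hG, -⟩
  exact h (by rwa [Subsingleton.elim ⊥ G])

/-- The inclusion-exclusion for `n = 2`, where there are no 2-graphs, reads `-c = c - 2c'`. It
expresses both small corrections through the one-vertex graph. -/
theorem LeafFamily.c_two (Q : LeafFamily) : Q.c 2 0 = Q.c 1 1 := by
  have h := Q.card_isTwoGraph 2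
  have h0 : Nat.card {G : SimpleGraph (Fin 2) // Q.Mem 0 G ∧ IsTwoGraph G} = 0 := by
    rw [Nat.card_eq_zero]
    exact .inl ⟨fun G => absurd G.2.2.three_le (by norm_num)⟩
  simp [h0, Finset.sum_range_succ] at h
  omega

/-! ### Coefficients of the substituted series -/

theorem coeff_egf₂ (c : ℕ → ℕ → ℕ) (a b : ℕ) :
    MvPowerSeries.coeff (Finsupp.single 0 a + Finsupp.single 1 b) (egf₂ c) = (c a b : ℚ) / a ! := by
  have h0 : (Finsupp.single 0 a + Finsupp.single 1 b : Fin 2 →₀ ℕ) 0 = a := by simp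
  have h1 : (Finsupp.single 0 a + Finsupp.single 1 b : Fin 2 →₀ ℕ) 1 = b := by simp
  rw [MvPowerSeries.coeff_apply, egf₂, h0, h1]

theorem coeff_expNeg_pow (d n : ℕ) :
    PowerSeries.coeff n ((PowerSeries.exp ℚ).subst (-PowerSeries.X : PowerSeries ℚ) ^ d) =
      (-d : ℚ) ^ n / n ! := by
  have h : (-PowerSeries.X : PowerSeries ℚ) = (-1 : ℚ) • PowerSeries.X := by simp
  rw [← PowerSeries.subst_pow hasSubst_negX, PowerSeries.exp_pow_eq_rescale_exp, h,
    ← PowerSeries.rescale_eq_subst, PowerSeries.rescale_rescale, PowerSeries.coeff_rescale,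
    PowerSeries.coeff_exp]
  simp [div_eq_mul_inv]

theorem coeff_expNegXY_pow (d : ℕ) (e : Fin 2 →₀ ℕ) :
    MvPowerSeries.coeff e ((PowerSeries.exp ℚ).subst
      (-(MvPowerSeries.X 0 * MvPowerSeries.X 1) : MvPowerSeries (Fin 2) ℚ) ^ d) =
      if e 0 = e 1 then (-d : ℚ) ^ e 0 / (e 0)! else 0 := by
  have hpow : ∀ k : ℕ, (-(MvPowerSeries.X 0 * MvPowerSeries.X 1) : MvPowerSeries (Fin 2) ℚ) ^ k =
      MvPowerSeries.monomial (Finsupp.single 0 k + Finsupp.single 1 k) ((-1 : ℚ) ^ k) := by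
    intro k
    rw [neg_pow, mul_pow, MvPowerSeries.X_pow_eq, MvPowerSeries.X_pow_eq,
      MvPowerSeries.monomial_mul_monomial]
    rw [← map_one (MvPowerSeries.C (σ := Fin 2) (R := ℚ)), ← map_neg, ← map_pow,
      ← MvPowerSeries.smul_eq_C_mul, ← map_smul]
    simp
  have he : ∀ k : ℕ, e = Finsupp.single 0 k + Finsupp.single 1 k ↔ e 0 = k ∧ e 1 = k := by
    intro k
    rw [Finsupp.ext_iff, Fin.forall_fin_two]
    simp
  rw [← PowerSeries.subst_pow hasSubst_negXY, PowerSeries.exp_pow_eq_rescale_exp,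
    PowerSeries.coeff_subst hasSubst_negXY, finsum_eq_single _ (e 0)]
  · rw [hpow, MvPowerSeries.coeff_monomial, PowerSeries.coeff_rescale, PowerSeries.coeff_exp]
    simp only [he, true_and, eq_comm (a := e 1)]
    split_ifs
    · rw [neg_pow (d : ℚ)]
      simp [div_eq_mul_inv]
      ring
    · simp
  · intro k hk
    rw [hpow, MvPowerSeries.coeff_monomial, if_neg, smul_zero]
    rw [he]
    exact fun h => hk h.1.symm

/-- The power `(x e^{-x})^d = x^d e^{-dx}` contributes only for `d ≤ n`; the index `j = n - d` is
the number of leaves. -/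
theorem coeff_subst_xExpNeg (F : PowerSeries ℚ) (n : ℕ) :
    PowerSeries.coeff n (F.subst xExpNeg) = ∑ j ∈ Finset.range (n + 1),
      PowerSeries.coeff (n - j) F * ((-(n - j : ℕ) : ℚ) ^ j / j !) := by
  rw [PowerSeries.coeff_subst' hasSubst_xExpNeg,
    finsum_eq_sum_of_support_subset (s := Finset.range (n + 1)),
    ← Finset.sum_range_reflect]
  · refine Finset.sum_congr rfl fun j hj => ?_
    have hj' : j ≤ n := Nat.lt_succ_iff.1 (Finset.mem_range.1 hj)
    rw [Nat.add_sub_cancel, xExpNeg, mul_pow, PowerSeries.coeff_X_pow_mul', if_pos (by omega),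
      coeff_expNeg_pow, show n - (n - j) = j by omega, smul_eq_mul]
  · intro d hd
    rw [Finset.mem_coe, Finset.mem_range]
    by_contra h
    refine hd ?_
    dsimp only
    rw [xExpNeg, mul_pow, PowerSeries.coeff_X_pow_mul', if_neg (by omega), smul_zero]

/-- Beyond `x^a y^b`, the factor `e^{-axy}` supplies equal powers of `x` and `y`, so a single index
`j` lowers both exponents. -/
theorem coeff_subst_xExpNegXY (F : MvPowerSeries (Fin 2) ℚ) (m : Fin 2 →₀ ℕ) :
    MvPowerSeries.coeff m (F.subst ![xExpNegXY, (MvPowerSeries.X 1 : MvPowerSeries (Fin 2) ℚ)]) =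
    ∑ j ∈ Finset.range (m 0 + 1), if j ≤ m 1 then
      MvPowerSeries.coeff (Finsupp.single 0 (m 0 - j) + Finsupp.single 1 (m 1 - j)) F *
        ((-(m 0 - j : ℕ) : ℚ) ^ j / j !) else 0 := by
  have hterm : ∀ d : Fin 2 →₀ ℕ, MvPowerSeries.coeff m (d.prod fun s e =>
      (![xExpNegXY, (MvPowerSeries.X 1 : MvPowerSeries (Fin 2) ℚ)] s) ^ e) =
      if d ≤ m ∧ m 0 - d 0 = m 1 - d 1 then
        (-(d 0) : ℚ) ^ (m 0 - d 0) / (m 0 - d 0)! else 0 := by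
    intro d
    have hd : Finsupp.single 0 (d 0) + Finsupp.single 1 (d 1) = d := by
      rw [Finsupp.ext_iff, Fin.forall_fin_two]
      simp
    rw [Finsupp.prod_fintype _ _ (by simp), Fin.prod_univ_two]
    simp only [Matrix.cons_val_zero, Matrix.cons_val_one]
    rw [xExpNegXY, mul_pow, mul_right_comm, MvPowerSeries.X_pow_eq, MvPowerSeries.X_pow_eq,
      MvPowerSeries.monomial_mul_monomial, hd, MvPowerSeries.coeff_monomial_mul,
      coeff_expNegXY_pow]
    simp only [ite_and, one_mul, Finsupp.tsub_apply]
    congr!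
  rw [MvPowerSeries.coeff_subst hasSubst_xExpNegXY]
  simp only [hterm]
  rw [← Finset.sum_filter]
  let ψ : ℕ → (Fin 2 →₀ ℕ) := fun j =>
    Finsupp.single 0 (m 0 - j) + Finsupp.single 1 (m 1 - j)
  have hψ0 : ∀ j, ψ j 0 = m 0 - j := fun j => by simp [ψ]
  have hψ1 : ∀ j, ψ j 1 = m 1 - j := fun j => by simp [ψ]
  have hle : ∀ d : Fin 2 →₀ ℕ, d ≤ m ↔ d 0 ≤ m 0 ∧ d 1 ≤ m 1 := by
    intro d
    rw [Finsupp.le_def, Fin.forall_fin_two]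
  rw [finsum_eq_sum_of_support_subset
    (s := ((Finset.range (m 0 + 1)).filter (· ≤ m 1)).image ψ), Finset.sum_image]
  · refine Finset.sum_congr rfl fun j hj => ?_
    rw [Finset.mem_filter, Finset.mem_range] at hj
    rw [if_pos ⟨(hle _).2 ⟨by rw [hψ0]; omega, by rw [hψ1]; omega⟩,
      by rw [hψ0, hψ1]; omega⟩, hψ0, show m 0 - (m 0 - j) = j by omega, smul_eq_mul]
  · intro j hj j' hj' h
    simp only [Finset.coe_filter, Finset.mem_range, Set.mem_ofPred_eq] at hj hj'
    have := congrArg (· 0) h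
    simp only [hψ0] at this
    omega
  · intro d hd
    rw [Function.mem_support] at hd
    have hd' : d ≤ m ∧ m 0 - d 0 = m 1 - d 1 := by
      by_contra h
      rw [if_neg h, smul_zero] at hd
      exact hd rfl
    rw [hle] at hd'
    rw [Finset.mem_coe, Finset.mem_image]
    refine ⟨m 0 - d 0, ?_, ?_⟩
    · rw [Finset.mem_filter, Finset.mem_range]
      omega
    · rw [Finsupp.ext_iff, Fin.forall_fin_two, hψ0, hψ1]
      omega

/-! ### From counts to generating functions -/

theorem choose_div_factorial {n j : ℕ} (hj : j ≤ n) (a b : ℚ) :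
    a / (n - j)! * (b / j !) = (n.choose j * (a * b)) / n ! := by
  rw [Nat.cast_choose ℚ hj]
  field_simp

theorem LeafFamily.card_isTwoGraph_div (Q : LeafFamily) (n : ℕ) :
    (Nat.card {G : SimpleGraph (Fin n) // Q.Mem 0 G ∧ IsTwoGraph G} : ℚ) / n ! =
      (∑ j ∈ Finset.range (n + 1), (Q.c (n - j) j : ℚ) / (n - j)! *
        ((-(n - j : ℕ) : ℚ) ^ j / j !)) -
      (if n = 1 then (Q.c 1 0 : ℚ) else 0) + (if n = 2 then (Q.c 1 1 : ℚ) / 2 else 0) := by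
  have h := congrArg (Int.cast : ℤ → ℚ) (Q.card_isTwoGraph n)
  have hs : (∑ j ∈ Finset.range (n + 1), (Q.c (n - j) j : ℚ) / (n - j)! *
      ((-(n - j : ℕ) : ℚ) ^ j / j !)) = (∑ j ∈ Finset.range (n + 1),
      (n.choose j : ℚ) * ((-1) ^ j * (Q.c (n - j) j * ((n - j : ℕ) : ℚ) ^ j))) / n ! := by
    rw [Finset.sum_div]
    refine Finset.sum_congr rfl fun j hj => ?_
    rw [choose_div_factorial (Nat.lt_succ_iff.1 (Finset.mem_range.1 hj)), neg_pow]
    ring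
  rw [hs]
  rcases eq_or_ne n 1 with rfl | h1
  · simp at h ⊢
    linarith
  rcases eq_or_ne n 2 with rfl | h2
  · rw [if_neg (by norm_num), if_pos rfl, Q.c_two] at h
    push_cast at h
    rw [if_neg (by norm_num), if_pos rfl, ← h]
    simp
    ring
  · rw [if_neg h1, if_neg h2] at h ⊢
    push_cast at h
    rw [← h]
    ring

theorem egf_isTwoGraph (Q : LeafFamily) (c : ℕ → ℕ) (hc : ∀ n j, Q.c n j = c n)
    (h0 : ∀ j, Q.Mem j (⊥ : SimpleGraph (Fin 1))) :
    egf (fun n => Nat.card {G : SimpleGraph (Fin n) // Q.Mem 0 G ∧ IsTwoGraph G}) =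
      (egf c).subst xExpNeg - PowerSeries.X
        + (1 / 2 : ℚ) • (PowerSeries.X : PowerSeries ℚ) ^ 2 := by
  ext n
  rw [map_add, map_sub, coeff_subst_xExpNeg, egf, PowerSeries.coeff_mk, Q.card_isTwoGraph_div,
    Q.c_one (h0 0), Q.c_one (h0 1), PowerSeries.coeff_X, map_smul, PowerSeries.coeff_X_pow]
  simp only [egf, PowerSeries.coeff_mk, hc]
  congr 1
  simp

/-! ### The tree series -/

theorem isTree_attachLeaves_iff {A B : Type} [Finite A] [Finite B] {G : SimpleGraph A}
    (f : B → A) : (attachLeaves G f).IsTree ↔ G.IsTree := by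
  rw [SimpleGraph.isTree_iff_connected_and_card, SimpleGraph.isTree_iff_connected_and_card,
    attachLeaves_connected_iff, Nat.card_coe_set_eq, Nat.card_coe_set_eq,
    ncard_edgeSet_attachLeaves, Nat.card_sum]
  refine and_congr_right fun _ => ?_
  omega

theorem isTree_of_iso {V W : Type} {G : SimpleGraph V} {G' : SimpleGraph W} (i : G ≃g G')
    (h : G.IsTree) : G'.IsTree :=
  ⟨i.connected_iff.1 h.1, h.2.comap i.symm.toHom i.symm.injective⟩

/-- Trees, as a family closed under attaching leaves. -/
def treeFamily : LeafFamily where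
  Mem _ _ G := G.IsTree
  mem_of_iso i h := isTree_of_iso i h
  mem_attachLeaves_iff f _ := isTree_attachLeaves_iff f

theorem not_isTree_of_isTwoGraph {n : ℕ} {G : SimpleGraph (Fin n)} (h : IsTwoGraph G) :
    ¬ G.IsTree := by
  classical
  intro hT
  have : Nontrivial (Fin n) := Fin.nontrivial_iff_two_le.2 (by have := h.three_le; omega)
  obtain ⟨v, hv⟩ := hT.exists_vert_degree_one_of_nontrivial
  have h2 := h.2 v
  rw [← SimpleGraph.coe_neighborFinset, Set.encard_coe_eq_coe_finsetCard,
    SimpleGraph.card_neighborFinset_eq_degree, hv] at h2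
  exact absurd h2 (by decide)

/-- The formula for `H` applied to trees, where the left side vanishes because a tree on at least
two vertices has a leaf. -/
theorem unrootedTrees_subst :
    unrootedTrees.subst xExpNeg =
      PowerSeries.X - (1 / 2 : ℚ) • (PowerSeries.X : PowerSeries ℚ) ^ 2 := by
  have h := egf_isTwoGraph treeFamily
    (fun n => Nat.card {G : SimpleGraph (Fin n) // G.IsTree})
    (fun n j => Nat.card_congr (Equiv.subtypeEquivRight fun G => ⟨fun h => h.1, fun h => ⟨h, h.1⟩⟩))
    (fun _ => SimpleGraph.IsTree.of_subsingleton)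
  have h0 : egf (fun n => Nat.card
      {G : SimpleGraph (Fin n) // treeFamily.Mem 0 G ∧ IsTwoGraph G}) = 0 := by
    ext n
    have : Nat.card {G : SimpleGraph (Fin n) // treeFamily.Mem 0 G ∧ IsTwoGraph G} = 0 :=
      Nat.card_eq_zero.2 (.inl ⟨fun G => not_isTree_of_isTwoGraph G.2.2 G.2.1⟩)
    simp [egf, this]
  rw [h0] at h
  change 0 = unrootedTrees.subst xExpNeg - _ + _ at h
  linear_combination -h

theorem rootedTrees_eq : rootedTrees = PowerSeries.X * PowerSeries.derivative ℚ unrootedTrees := by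
  have hcard : ∀ n, Nat.card {p : SimpleGraph (Fin n) × Fin n // p.1.IsTree} =
      Nat.card {G : SimpleGraph (Fin n) // G.IsTree} * n := by
    intro n
    rw [Nat.card_congr Equiv.prodSubtypeFstEquivSubtypeProd (α := _), Nat.card_prod, Nat.card_fin]
  ext n
  rcases n with _ | n
  · simp [rootedTrees, egf]
  · rw [PowerSeries.coeff_succ_X_mul, PowerSeries.coeff_derivative, rootedTrees, unrootedTrees]
    simp only [egf, PowerSeries.coeff_mk, hcard]
    push_cast
    ring

theorem derivative_xExpNeg : PowerSeries.derivative ℚ xExpNeg =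
    (1 - PowerSeries.X) * (PowerSeries.exp ℚ).subst (-PowerSeries.X : PowerSeries ℚ) := by
  rw [xExpNeg, Derivation.leibniz, PowerSeries.derivative_subst hasSubst_negX,
    PowerSeries.derivative_exp]
  simp
  ring

/-- The derivatives of `x e^{-x}` and of `x - x²/2` share the factor `1 - x`. Cancelling it in the
differentiated identity for `U` gives `U'(x e^{-x}) e^{-x} = 1`. -/
theorem rootedTrees_subst : rootedTrees.subst xExpNeg = PowerSeries.X := by
  have h := congrArg (PowerSeries.derivative ℚ) unrootedTrees_subst
  rw [PowerSeries.derivative_subst hasSubst_xExpNeg, derivative_xExpNeg] at h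
  have h1 : PowerSeries.derivative ℚ
      (PowerSeries.X - (1 / 2 : ℚ) • (PowerSeries.X : PowerSeries ℚ) ^ 2) =
      1 - PowerSeries.X := by
    rw [map_sub, Derivation.map_smul, Derivation.leibniz_pow, ← Nat.cast_smul_eq_nsmul ℚ,
      smul_smul]
    simp
  rw [h1] at h
  have hne : (1 - PowerSeries.X : PowerSeries ℚ) ≠ 0 := by
    intro h
    simpa using congrArg PowerSeries.constantCoeff h
  have h2 : (PowerSeries.derivative ℚ unrootedTrees).subst xExpNeg *
      (PowerSeries.exp ℚ).subst (-PowerSeries.X : PowerSeries ℚ) = 1 := by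
    apply mul_left_cancel₀ hne
    linear_combination h
  rw [rootedTrees_eq, PowerSeries.subst_mul hasSubst_xExpNeg,
    PowerSeries.subst_X hasSubst_xExpNeg]
  calc xExpNeg * (PowerSeries.derivative ℚ unrootedTrees).subst xExpNeg
      = PowerSeries.X * ((PowerSeries.derivative ℚ unrootedTrees).subst xExpNeg *
          (PowerSeries.exp ℚ).subst (-PowerSeries.X : PowerSeries ℚ)) := by
        rw [xExpNeg]; ring
    _ = PowerSeries.X := by rw [h2, mul_one]

/-- The linear coefficient of `x e^{-x}` is a unit, so there is a compositional inverse. -/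
theorem subst_xExpNeg_injective : Function.Injective
    (fun F : PowerSeries ℚ => F.subst xExpNeg) := by
  have hconst : PowerSeries.constantCoeff xExpNeg = 0 := by simp [xExpNeg]
  have hu : IsUnit (PowerSeries.coeff 1 xExpNeg) := by
    have := coeff_expNeg_pow 1 0
    rw [pow_one] at this
    rw [xExpNeg, PowerSeries.coeff_succ_X_mul, this]
    simp
  have hinv := PowerSeries.HasSubst.substInvOfIsUnit xExpNeg hu
  intro F G h
  have h' := congrArg (PowerSeries.subst (PowerSeries.substInvOfIsUnit xExpNeg hu)) h
  simp only at h'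
  rwa [PowerSeries.subst_comp_subst_apply hasSubst_xExpNeg hinv,
    PowerSeries.subst_comp_subst_apply hasSubst_xExpNeg hinv,
    PowerSeries.subst_substInvOfIsUnit_right _ hconst, PowerSeries.X_subst,
    PowerSeries.X_subst] at h'

/-! ### The identities for core-closed classes -/

namespace GraphClass

variable {𝒢 : GraphClass}

/-- The members of a core-closed class, as a family closed under attaching leaves. -/
def leafFamily (h𝒢 : 𝒢.CoreClosed) : LeafFamily where
  Mem _ _ G := 𝒢.Mem G
  mem_of_iso i h := 𝒢.mem_of_iso i h
  mem_attachLeaves_iff f hG := h𝒢.mem_attachLeaves_iff hG f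

theorem ncard_edgeSet_of_iso {V W : Type} {G : SimpleGraph V} {G' : SimpleGraph W}
    (i : G ≃g G') : G.edgeSet.ncard = G'.edgeSet.ncard := by
  rw [← Nat.card_coe_set_eq, ← Nat.card_coe_set_eq]
  exact Nat.card_congr i.mapEdgeSet

/-- The members of a core-closed class with `m` edges, counting leaves still to be attached. -/
def edgeLeafFamily (h𝒢 : 𝒢.CoreClosed) (m : ℕ) : LeafFamily where
  Mem j _ G := 𝒢.Mem G ∧ G.edgeSet.ncard + j = m
  mem_of_iso i h := ⟨𝒢.mem_of_iso i h.1, ncard_edgeSet_of_iso i ▸ h.2⟩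
  mem_attachLeaves_iff f hG := by
    rw [h𝒢.mem_attachLeaves_iff hG f, ncard_edgeSet_attachLeaves, add_assoc, add_comm (Nat.card _)]

theorem CoreClosed.mem_bot (h𝒢 : 𝒢.CoreClosed) : 𝒢.Mem (⊥ : SimpleGraph (Fin 1)) := by
  rw [h𝒢 _ SimpleGraph.Connected.of_subsingleton]
  left
  have hv : ∀ v, v ∉ (core (⊥ : SimpleGraph (Fin 1))).verts := by
    intro v hv
    have h := (core_isGreatest (⊥ : SimpleGraph (Fin 1))).1 ⟨v, hv⟩
    have he : (core (⊥ : SimpleGraph (Fin 1))).coe.neighborSet ⟨v, hv⟩ = ∅ :=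
      Set.eq_empty_of_forall_notMem fun w hw =>
        ((core (⊥ : SimpleGraph (Fin 1))).adj_sub hw).elim
    rw [he, Set.encard_empty] at h
    exact absurd h (by decide)
  ext a b
  · simpa using hv a
  · exact ⟨fun h => absurd h.fst_mem (hv a), fun h => h.elim⟩

theorem CoreClosed.H_eq (h𝒢 : 𝒢.CoreClosed) : 𝒢.H = 𝒢.C.subst xExpNeg - PowerSeries.X
    + (1 / 2 : ℚ) • (PowerSeries.X : PowerSeries ℚ) ^ 2 :=
  egf_isTwoGraph (leafFamily h𝒢) _ (fun _ _ => rfl) fun _ => h𝒢.mem_bot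

theorem CoreClosed.C_eq (h𝒢 : 𝒢.CoreClosed) : 𝒢.C = 𝒢.H.subst rootedTrees + unrootedTrees := by
  apply subst_xExpNeg_injective
  dsimp only
  rw [PowerSeries.subst_add hasSubst_xExpNeg,
    PowerSeries.subst_comp_subst_apply hasSubst_rootedTrees hasSubst_xExpNeg, rootedTrees_subst,
    PowerSeries.X_subst, unrootedTrees_subst, h𝒢.H_eq]
  ring

theorem edgeLeafFamily_c (h𝒢 : 𝒢.CoreClosed) (m n j : ℕ) :
    (edgeLeafFamily h𝒢 m).c n j = if j ≤ m then Nat.card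
      {G : SimpleGraph (Fin n) // 𝒢.Mem G ∧ G.Connected ∧ G.edgeSet.ncard = m - j} else 0 := by
  split_ifs with h
  · refine Nat.card_congr (Equiv.subtypeEquivRight fun G => ?_)
    change (𝒢.Mem G ∧ _ + j = m) ∧ _ ↔ _
    rw [and_assoc, and_comm (b := G.Connected)]
    refine and_congr_right fun _ => and_congr_right fun _ => ?_
    omega
  · refine Nat.card_eq_zero.2 (.inl ⟨?_⟩)
    rintro ⟨G, ⟨-, hG⟩, -⟩
    omega

theorem CoreClosed.H₂_eq (h𝒢 : 𝒢.CoreClosed) :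
    𝒢.H₂ = 𝒢.C₂.subst ![xExpNegXY, MvPowerSeries.X 1] - MvPowerSeries.X 0
      + (1 / 2 : ℚ) • ((MvPowerSeries.X 0 : MvPowerSeries (Fin 2) ℚ) ^ 2
        * MvPowerSeries.X 1) := by
  ext m
  have hH : MvPowerSeries.coeff m 𝒢.H₂ = (Nat.card {G : SimpleGraph (Fin (m 0)) //
      (edgeLeafFamily h𝒢 (m 1)).Mem 0 G ∧ IsTwoGraph G} : ℚ) / (m 0)! := by
    change (Nat.card _ : ℚ) / _ = _
    congr 2
    refine Nat.card_congr (Equiv.subtypeEquivRight fun G => ?_)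
    change _ ↔ (𝒢.Mem G ∧ _ + 0 = _) ∧ _
    rw [and_assoc, and_comm (a := IsTwoGraph G), add_zero]
  -- The one-vertex graph has no edges, so it counts only if all `m 1` edges come from leaves to be
  -- attached. With `j = 0` and `j = 1` this yields the monomials `x` and `x²y`.
  have hc1 : ∀ j, ((edgeLeafFamily h𝒢 (m 1)).c 1 j : ℚ) = if m 1 = j then 1 else 0 := by
    intro j
    split_ifs with h
    · rw [LeafFamily.c_one, Nat.cast_one]
      exact ⟨h𝒢.mem_bot, by simp [h]⟩
    · rw [LeafFamily.c_one_of_not, Nat.cast_zero]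
      rintro ⟨-, h'⟩
      simp at h'
      exact h h'.symm
  have hm : ∀ a b : ℕ, m = Finsupp.single 0 a + Finsupp.single 1 b ↔ m 0 = a ∧ m 1 = b := by
    intro a b
    rw [Finsupp.ext_iff, Fin.forall_fin_two]
    simp
  have hX : (MvPowerSeries.X 0 : MvPowerSeries (Fin 2) ℚ) =
      MvPowerSeries.monomial (Finsupp.single 0 1 + Finsupp.single 1 0) 1 := by
    rw [MvPowerSeries.X, Finsupp.single_zero, add_zero]
  have hXX : (MvPowerSeries.X 0 : MvPowerSeries (Fin 2) ℚ) ^ 2 * MvPowerSeries.X 1 =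
      MvPowerSeries.monomial (Finsupp.single 0 2 + Finsupp.single 1 1) 1 := by
    rw [MvPowerSeries.X_pow_eq, MvPowerSeries.X, MvPowerSeries.monomial_mul_monomial, one_mul]
  rw [hH, LeafFamily.card_isTwoGraph_div, map_add, map_sub, coeff_subst_xExpNegXY, map_smul, hXX,
    hX, MvPowerSeries.coeff_monomial, MvPowerSeries.coeff_monomial]
  simp only [hm, hc1]
  congr 1
  · congr 1
    · refine Finset.sum_congr rfl fun j _ => ?_
      rw [edgeLeafFamily_c]
      split_ifs
      · congr 1
        rw [GraphClass.C₂, coeff_egf₂]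
      · simp
    · simp only [ite_and]
  · simp only [ite_and]
    split_ifs <;> simp

theorem all_coreClosed : GraphClass.all.CoreClosed :=
  fun _ _ => ⟨fun _ => .inr trivial, fun _ => trivial⟩

end GraphClass

/-! ### Arcs and discs -/

/-- `A` is a simple arc from `x` to `y`. -/
def IsArc {X : Type*} [TopologicalSpace X] (x y : X) (A : Set X) : Prop :=
  ∃ γ : Path x y, Function.Injective γ ∧ Set.range γ = A

section IsArc

variable {X : Type*} [TopologicalSpace X] {x y z : X} {A B : Set X}

theorem IsArc.symm (h : IsArc x y A) : IsArc y x A := by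
  obtain ⟨γ, hγ, rfl⟩ := h
  refine ⟨γ.symm, ?_, γ.symm_range⟩
  exact hγ.comp (unitInterval.symm_bijective).injective

theorem IsArc.isCompact (h : IsArc x y A) : IsCompact A := by
  obtain ⟨γ, -, rfl⟩ := h
  exact isCompact_range γ.continuous

theorem IsArc.trans (hA : IsArc x y A) (hB : IsArc y z B) (h : A ∩ B ⊆ {y}) :
    IsArc x z (A ∪ B) := by
  obtain ⟨γ, hγ, rfl⟩ := hA
  obtain ⟨δ, hδ, rfl⟩ := hB
  refine ⟨γ.trans δ, ?_, γ.trans_range δ⟩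
  have key : ∀ s t : unitInterval, γ s = δ t → t = 0 := by
    intro s t hst
    have : δ t = y := h ⟨⟨s, hst⟩, ⟨t, rfl⟩⟩
    exact hδ (this.trans δ.source.symm)
  intro s t hst
  rw [Path.trans_apply, Path.trans_apply] at hst
  split_ifs at hst with hs ht ht
  · have := congrArg Subtype.val (hγ hst)
    exact Subtype.ext (by simpa using this)
  · have := congrArg Subtype.val (key _ _ hst)
    simp at this
    linarith
  · have := congrArg Subtype.val (key _ _ hst.symm)
    simp at this
    linarith
  · have := congrArg Subtype.val (hδ hst)
    exact Subtype.ext (by simpa using this)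

theorem isArc_image_Icc (γ : Path x y) (hγ : Function.Injective γ) {t : unitInterval}
    (ht : t < 1) : IsArc (γ t) y (γ '' Set.Icc t 1) := by
  refine ⟨(γ.subpath t 1).cast rfl γ.target.symm, ?_, ?_⟩
  · intro a b hab
    have h := congrArg Subtype.val (hγ hab)
    simp only [Set.Icc.coe_convexComb, Set.Icc.coe_one] at h
    have ht' : (t : ℝ) < 1 := ht
    have : (1 - (t : ℝ)) * (a - b) = 0 := by linear_combination h
    rcases mul_eq_zero.1 this with h | h
    · linarith
    · exact Subtype.ext (sub_eq_zero.1 h)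
  · rw [Path.cast_coe, Path.range_subpath_of_le _ _ _ ht.le]

end IsArc

theorem isArc_segment {E : Type*} [NormedAddCommGroup E] [NormedSpace ℝ E] {x y : E}
    (h : x ≠ y) : IsArc x y (segment ℝ x y) := by
  refine ⟨⟨⟨fun t => AffineMap.lineMap x y (t : ℝ), by fun_prop⟩, by simp, by simp⟩, ?_, ?_⟩
  · intro s t hst
    exact Subtype.ext (AffineMap.lineMap_injective ℝ h hst)
  · rw [segment_eq_image_lineMap, Set.image_eq_range]
    rfl

section discs

variable {E : Type*} [NormedAddCommGroup E] [NormedSpace ℝ E] {x y z z' p : E} {r : ℝ}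

/-- Comparing distances from the centre forces equal parameters on the two radii, and a nonzero
parameter would make their ends equal. -/
theorem eq_center_of_mem_segment (hz : z ∈ Metric.sphere x r) (hz' : z' ∈ Metric.sphere x r)
    (hne : z ≠ z') (hp : p ∈ segment ℝ x z) (hp' : p ∈ segment ℝ x z') : p = x := by
  rw [segment_eq_image'] at hp hp'
  obtain ⟨t, ht, rfl⟩ := hp
  obtain ⟨t', ht', h⟩ := hp'
  have h' : t' • (z' - x) = t • (z - x) := add_left_cancel h
  rw [mem_sphere_iff_norm] at hz hz'
  have hn := congrArg norm h'
  rw [norm_smul, norm_smul, hz, hz', Real.norm_of_nonneg ht.1, Real.norm_of_nonneg ht'.1] at hn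
  rcases eq_or_ne r 0 with rfl | hr
  · simp [norm_eq_zero.1 hz]
  · have htt : t' = t := mul_right_cancel₀ hr hn
    subst htt
    rcases eq_or_ne t' 0 with rfl | ht0
    · simp
    · exact absurd (sub_left_injective (smul_right_injective E ht0 h')) hne.symm

theorem segment_subset_closedBall (hz : z ∈ Metric.sphere x r) :
    segment ℝ x z ⊆ Metric.closedBall x r :=
  (convex_closedBall x r).segment_subset
    (Metric.mem_closedBall_self (hz ▸ dist_nonneg)) (Metric.sphere_subset_closedBall hz)

/-- An arc leaving a disc around its starting point can be made straight inside the disc. -/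
theorem IsArc.exists_straighten {A : Set E} (hA : IsArc x y A) (hr : 0 < r)
    (hy : y ∉ Metric.closedBall x r) :
    ∃ z ∈ A, z ∈ Metric.sphere x r ∧ ∃ A', IsArc x y A' ∧
      ∀ p ∈ A', (p ∉ Metric.closedBall x r ∧ p ∈ A) ∨ p ∈ segment ℝ x z := by
  obtain ⟨γ, hγ, rfl⟩ := hA
  have hclosed : IsClosed (γ ⁻¹' Metric.closedBall x r) :=
    Metric.isClosed_closedBall.preimage γ.continuous
  -- `t` is the last time in the disc. The rest of the arc stays outside, so it can follow the
  -- radius to `γ t`.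
  obtain ⟨t, ht, hmax⟩ := hclosed.isCompact.exists_isGreatest
    ⟨0, by simp [hr.le]⟩
  have ht1 : t < 1 := by
    refine lt_of_le_of_ne unitInterval.le_one' fun h => hy ?_
    have : γ t ∈ Metric.closedBall x r := ht
    rwa [h, γ.target] at this
  have hout : ∀ s, t < s → γ s ∉ Metric.closedBall x r := fun s hs h =>
    absurd (hmax h) (not_le.2 hs)
  have hsphere : γ t ∈ Metric.sphere x r := by
    refine le_antisymm ht ?_
    have : (nhdsWithin t (Set.Ioi t)).NeBot := nhdsGT_neBot_of_exists_gt ⟨1, ht1⟩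
    refine ge_of_tendsto (x := nhdsWithin t (Set.Ioi t)) (f := fun s => dist (γ s) x)
      ((γ.continuous.dist continuous_const).continuousAt.tendsto.mono_left nhdsWithin_le_nhds) ?_
    filter_upwards [self_mem_nhdsWithin] with s hs
    exact (not_le.1 (hout s hs)).le
  have hne : x ≠ γ t := by
    rintro h
    rw [← h] at hsphere
    simp [hr.ne] at hsphere
  refine ⟨γ t, ⟨t, rfl⟩, hsphere, _,
    (isArc_segment hne).trans (isArc_image_Icc γ hγ ht1) ?_, ?_⟩
  · rintro p ⟨hp, s, hs, rfl⟩
    rcases hs.1.eq_or_lt with rfl | hlt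
    · rfl
    · exact absurd (segment_subset_closedBall hsphere hp) (hout s hlt)
  · rintro p (hp | ⟨s, hs, rfl⟩)
    · exact .inr hp
    · rcases hs.1.eq_or_lt with rfl | hlt
      · exact .inr (right_mem_segment ℝ _ _)
      · exact .inl ⟨hout s hlt, s, rfl⟩

theorem infinite_sphere (h : 1 < Module.rank ℝ E) (x : E) (hr : 0 < r) :
    (Metric.sphere x r).Infinite := by
  refine (isPreconnected_sphere h x r).infinite_of_nontrivial ?_
  have : Nontrivial E := (rank_pos_iff_nontrivial (R := ℝ)).1 (zero_lt_one.trans h)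
  obtain ⟨u, hu⟩ := NormedSpace.sphere_nonempty (E := E) (x := 0).2 hr.le
  rw [mem_sphere_zero_iff_norm] at hu
  refine ⟨x + u, by simp [hu], x - u, by simp [hu], fun h => ?_⟩
  have h2 : (2 : ℝ) • u = 0 := by
    rw [two_smul]
    have : x + u - (x - u) = 0 := sub_eq_zero.2 h
    rw [← this]
    abel
  have : u = 0 := by simpa using h2
  rw [this, norm_zero] at hu
  exact hr.ne hu

end discs

/-! ### Modifying planar drawings -/

theorem IsPlanar.of_hom_injective {V W : Type} {G : SimpleGraph V} {H : SimpleGraph W}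
    (ψ : H →g G) (hψ : Function.Injective ψ) (h : IsPlanar G) : IsPlanar H := by
  obtain ⟨pos, arc, hinj, harc, hvert, hcross⟩ := h
  have hmem : ∀ e ∈ H.edgeSet, Sym2.map ψ e ∈ G.edgeSet := fun e he =>
    SimpleGraph.Hom.map_mem_edgeSet ψ he
  have hback : ∀ (e : Sym2 W) (w : W), ψ w ∈ Sym2.map ψ e → w ∈ e := by
    intro e w hw
    obtain ⟨a, ha, h⟩ := Sym2.mem_map.1 hw
    rwa [← hψ h]
  refine ⟨pos ∘ ψ, fun e => arc (Sym2.map ψ e), hinj.comp hψ, ?_, ?_, ?_⟩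
  · intro u v huv
    simpa using harc _ _ (ψ.map_adj huv)
  · intro e he w hw
    exact hback e w (hvert _ (hmem e he) _ hw)
  · intro e he f hf hef x hxe hxf
    obtain ⟨w, h1, h2, h3⟩ := hcross _ (hmem e he) _ (hmem f hf)
      (fun h => hef (Sym2.map.injective hψ h)) x hxe hxf
    obtain ⟨a, ha, rfl⟩ := Sym2.mem_map.1 h1
    exact ⟨a, ha, hback f a h2, h3⟩

/-- Isolated vertices can be added to a planar drawing. -/
theorem IsPlanar.map {V W : Type} [Finite V] [Finite W] {H : SimpleGraph W} (f : W ↪ V)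
    (h : IsPlanar H) : IsPlanar (H.map f) := by
  classical
  obtain ⟨pos, arc, hinj, harc, hvert, hcross⟩ := h
  have harc' : ∀ e ∈ H.edgeSet, Bornology.IsBounded (arc e) := by
    intro e he
    induction e with | h a b
    exact (show IsArc _ _ _ from harc a b he).isCompact.isBounded
  have hbdd : Bornology.IsBounded (Set.range pos ∪ ⋃ e ∈ H.edgeSet, arc e) :=
    (Set.finite_range pos).isBounded.union
      ((Bornology.isBounded_biUnion (Set.toFinite _)).2 harc')
  obtain ⟨R, hR⟩ := hbdd.exists_norm_le
  obtain ⟨n, ⟨i⟩⟩ := Finite.exists_equiv_fin V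
  -- The extra vertices go to distinct points on a ray beyond the bounded drawing; `R` has no known
  -- sign, hence `|R|`.
  let far : V → EuclideanSpace ℝ (Fin 2) := fun v => EuclideanSpace.single 0 (|R| + 1 + (i v : ℝ))
  have hfar_norm : ∀ v, R < ‖far v‖ := by
    intro v
    have h0 : (0 : ℝ) ≤ (i v : ℝ) := Nat.cast_nonneg _
    have h1 := abs_nonneg R
    rw [PiLp.norm_single, Real.norm_of_nonneg (by linarith)]
    linarith [le_abs_self R]
  have hfar_inj : Function.Injective far := by
    intro v w hvw
    have := congrArg (fun p : EuclideanSpace ℝ (Fin 2) => p 0) hvw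
    simp only [far, PiLp.single_apply, if_true, add_right_inj, Nat.cast_inj] at this
    exact i.injective (Fin.ext this)
  have hpos_ne : ∀ w v, pos w ≠ far v := fun w v h =>
    absurd (hR _ (.inl ⟨w, h⟩)) (not_le.2 (hfar_norm v))
  have harc_ne : ∀ e ∈ H.edgeSet, ∀ v, far v ∉ arc e := fun e he v h =>
    absurd (hR _ (.inr (Set.mem_biUnion he h))) (not_le.2 (hfar_norm v))
  have hedge : ∀ e ∈ (H.map f).edgeSet, ∃ e' ∈ H.edgeSet, Sym2.map f e' = e := by
    intro e he
    rw [SimpleGraph.edgeSet_map] at he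
    exact he
  have hposf : ∀ w, Function.extend f pos far (f w) = pos w := fun w =>
    f.injective.extend_apply _ _ _
  have harcf : ∀ e, Function.extend (Sym2.map f) arc (fun _ => ∅) (Sym2.map f e) = arc e :=
    fun e => (Sym2.map.injective f.injective).extend_apply _ _ _
  have hmemf : ∀ w e, f w ∈ Sym2.map f e ↔ w ∈ e := by
    intro w e
    simp [Sym2.mem_map]
  refine ⟨Function.extend f pos far, Function.extend (Sym2.map f) arc fun _ => ∅, ?_, ?_, ?_, ?_⟩
  · intro v w hvw
    by_cases hv : ∃ a, f a = v <;> by_cases hw : ∃ b, f b = w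
    · obtain ⟨a, rfl⟩ := hv
      obtain ⟨b, rfl⟩ := hw
      rw [hposf, hposf] at hvw
      rw [hinj hvw]
    · obtain ⟨a, rfl⟩ := hv
      rw [hposf, Function.extend_apply' _ _ _ hw] at hvw
      exact absurd hvw (hpos_ne _ _)
    · obtain ⟨b, rfl⟩ := hw
      rw [hposf, Function.extend_apply' _ _ _ hv] at hvw
      exact absurd hvw.symm (hpos_ne _ _)
    · rw [Function.extend_apply' _ _ _ hv, Function.extend_apply' _ _ _ hw] at hvw
      exact hfar_inj hvw
  · rintro _ _ ⟨-, a, b, hab, rfl, rfl⟩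
    rw [← Sym2.map_mk, harcf, hposf, hposf]
    exact harc a b hab
  · intro e he w hw
    obtain ⟨e, he', rfl⟩ := hedge e he
    rw [harcf] at hw
    by_cases h : ∃ a, f a = w
    · obtain ⟨a, rfl⟩ := h
      rw [hposf] at hw
      exact (hmemf _ _).2 (hvert e he' a hw)
    · rw [Function.extend_apply' _ _ _ h] at hw
      exact absurd hw (harc_ne e he' w)
  · intro e hfe e' hfe' hne x hx hx'
    obtain ⟨e, he, rfl⟩ := hedge e hfe
    obtain ⟨e', he', rfl⟩ := hedge e' hfe'
    rw [harcf] at hx hx'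
    obtain ⟨w, h1, h2, h3⟩ := hcross e he e' he' (fun h => hne (h ▸ rfl)) x hx hx'
    exact ⟨f w, (hmemf _ _).2 h1, (hmemf _ _).2 h2, by rw [hposf, h3]⟩

/-- An isolated vertex of a planar graph can be joined to another vertex. -/
theorem IsPlanar.sup_edge {V : Type} [Finite V] {H : SimpleGraph V} {l v : V} (hlv : l ≠ v)
    (hl : ∀ u, ¬ H.Adj l u) (h : IsPlanar H) : IsPlanar (H ⊔ SimpleGraph.edge l v) := by
  classical
  obtain ⟨pos, arc, hinj, harc, hvert, hcross⟩ := h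
  have hle : ∀ e ∈ H.edgeSet, l ∉ e := by
    intro e he hle
    obtain ⟨u, rfl⟩ := hle
    exact hl u he
  -- The disc around `v` must miss all other vertices and all edges not at `v`: finitely many closed
  -- sets that avoid `pos v`.
  have hclosed : IsClosed ((⋃ w ∈ {w | w ≠ v}, {pos w}) ∪ ⋃ e ∈ {e ∈ H.edgeSet | v ∉ e}, arc e) := by
    refine ((Set.toFinite _).isClosed_biUnion fun w _ => isClosed_singleton).union
      ((Set.toFinite _).isClosed_biUnion ?_)
    rintro e ⟨he, -⟩
    induction e with | h a b
    exact (show IsArc _ _ _ from harc a b he).isCompact.isClosed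
  have hv : pos v ∉ (⋃ w ∈ {w | w ≠ v}, {pos w}) ∪ ⋃ e ∈ {e ∈ H.edgeSet | v ∉ e}, arc e := by
    rintro (h | h)
    · obtain ⟨w, hw, h⟩ := Set.mem_iUnion₂.1 h
      exact hw (hinj h).symm
    · obtain ⟨e, he, h⟩ := Set.mem_iUnion₂.1 h
      exact he.2 (hvert e he.1 v h)
  obtain ⟨r, hr, hball⟩ := Metric.nhds_basis_closedBall.mem_iff.1 (hclosed.isOpen_compl.mem_nhds hv)
  set D := Metric.closedBall (pos v) r
  have hposD : ∀ w, w ≠ v → pos w ∉ D := fun w hw h =>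
    hball h (.inl (Set.mem_biUnion (show w ∈ {w | w ≠ v} from hw) rfl))
  have harcD : ∀ e ∈ H.edgeSet, v ∉ e → ∀ p ∈ arc e, p ∉ D := fun e he hve p hp h =>
    hball h (.inr (Set.mem_biUnion (show e ∈ {e ∈ H.edgeSet | v ∉ e} from ⟨he, hve⟩) hp))
  have hredraw : ∀ e : Sym2 V, ∃ (z : EuclideanSpace ℝ (Fin 2)) (A : Set (EuclideanSpace ℝ (Fin 2))),
      e ∈ H.edgeSet →
      (v ∈ e → z ∈ arc e ∧ z ∈ Metric.sphere (pos v) r) ∧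
      (∀ a b, s(a, b) = e → IsArc (pos a) (pos b) A) ∧
      (∀ p ∈ A, (p ∉ D ∧ p ∈ arc e) ∨ (v ∈ e ∧ p ∈ segment ℝ (pos v) z)) := by
    intro e
    by_cases he : e ∈ H.edgeSet
    swap
    · exact ⟨0, ∅, fun h => absurd h he⟩
    by_cases hve : v ∈ e
    · obtain ⟨u, rfl⟩ := hve
      have hu : u ≠ v := (SimpleGraph.Adj.ne (G := H) he).symm
      obtain ⟨z, hz, hzs, A, hA, hp⟩ :=
        (show IsArc _ _ _ from harc v u he).exists_straighten hr (hposD u hu)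
      refine ⟨z, A, fun _ => ⟨fun _ => ⟨hz, hzs⟩, ?_, fun p h => ?_⟩⟩
      · intro a b hab
        rcases Sym2.eq_iff.1 hab with ⟨rfl, rfl⟩ | ⟨rfl, rfl⟩
        exacts [hA, hA.symm]
      · exact (hp p h).imp id fun h => ⟨Sym2.mem_mk_left _ _, h⟩
    · refine ⟨0, arc e, fun _ => ⟨fun h => absurd h hve, ?_, fun p hp => ?_⟩⟩
      · rintro a b rfl
        exact harc a b he
      · exact .inl ⟨harcD e he hve p hp, hp⟩
  choose z A hzA using hredraw
  -- The circle is infinite and the exit points `z e` are finitely many, so some radius is free.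
  obtain ⟨z₀, hz₀, hz₀ne⟩ : ∃ z₀ ∈ Metric.sphere (pos v) r, z₀ ∉ Set.range z := by
    have hrank : 1 < Module.rank ℝ (EuclideanSpace ℝ (Fin 2)) := by
      rw [← Module.finrank_eq_rank, finrank_euclideanSpace_fin]
      norm_num
    exact ((infinite_sphere hrank (pos v) hr).sdiff (Set.finite_range z)).nonempty
  have hz₀' : pos v ≠ z₀ := by
    rintro rfl
    simp [hr.ne] at hz₀
  set q := midpoint ℝ (pos v) z₀
  have hqseg : q ∈ segment ℝ (pos v) z₀ := midpoint_mem_segment _ _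
  have hqv : pos v ≠ q := by
    intro h
    exact hz₀' ((midpoint_eq_left_iff ℝ).1 h.symm)
  have hsub : segment ℝ (pos v) q ⊆ segment ℝ (pos v) z₀ :=
    (convex_segment _ _).segment_subset (left_mem_segment ℝ _ _) hqseg
  have hsegD : segment ℝ (pos v) z₀ ⊆ D := segment_subset_closedBall hz₀
  -- distinct old edges at `v` leave the disc at distinct points
  have hzne : ∀ e ∈ H.edgeSet, ∀ f ∈ H.edgeSet, v ∈ e → v ∈ f → e ≠ f → z e ≠ z f := by
    intro e he f hf hve hvf hef hz
    obtain ⟨h1, h2⟩ := (hzA e he).1 hve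
    obtain ⟨h3, -⟩ := (hzA f hf).1 hvf
    obtain ⟨w, -, -, hw⟩ := hcross e he f hf hef _ h1 (hz ▸ h3)
    rw [hw] at h2
    by_cases hwv : w = v
    · subst hwv
      simp [hr.ne] at h2
    · exact hposD w hwv (Metric.sphere_subset_closedBall h2)
  -- points of old edges on the new segment
  have hold : ∀ e ∈ H.edgeSet, ∀ p ∈ A e, p ∈ segment ℝ (pos v) z₀ → v ∈ e ∧ p = pos v := by
    intro e he p hp hp₀
    rcases (hzA e he).2.2 p hp with ⟨h, -⟩ | ⟨hve, h⟩
    · exact absurd (hsegD hp₀) h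
    · exact ⟨hve, eq_center_of_mem_segment ((hzA e he).1 hve).2 hz₀
        (fun h => hz₀ne ⟨e, h⟩) h hp₀⟩
  have hnew : s(l, v) ∉ H.edgeSet := hl v
  have hedge : ∀ e ∈ (H ⊔ SimpleGraph.edge l v).edgeSet, e ∈ H.edgeSet ∨ e = s(l, v) := by
    intro e he
    rw [SimpleGraph.edgeSet_sup, SimpleGraph.edgeSet_edge_of_ne hlv] at he
    exact he
  have harcne : ∀ e ∈ H.edgeSet, Function.update A s(l, v) (segment ℝ (pos v) q) e = A e :=
    fun e he => Function.update_of_ne (fun h : e = s(l, v) => hnew (h ▸ he)) _ _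
  have hposne : ∀ w, w ≠ l → Function.update pos l q w = pos w :=
    fun w hw => Function.update_of_ne hw _ _
  -- The vertex `l` is moved to `q` inside the disc; being isolated in `H`, it is the end of no old
  -- arc.
  refine ⟨Function.update pos l q, Function.update A s(l, v) (segment ℝ (pos v) q), ?_, ?_, ?_, ?_⟩
  · have hqne : ∀ w, w ≠ l → pos w ≠ q := by
      intro w _ h
      by_cases hwv : w = v
      · exact hqv (hwv ▸ h)
      · exact hposD w hwv (h ▸ hsegD hqseg)
    intro a b hab
    by_cases ha : a = l <;> by_cases hb : b = l
    · rw [ha, hb]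
    · rw [ha, Function.update_self, hposne b hb] at hab
      exact absurd hab.symm (hqne b hb)
    · rw [hb, Function.update_self, hposne a ha] at hab
      exact absurd hab (hqne a ha)
    · rw [hposne a ha, hposne b hb] at hab
      exact hinj hab
  · intro a b hab
    change IsArc _ _ _
    rcases hedge s(a, b) hab with he | he
    · have ha : a ≠ l := fun h => hle _ he (h ▸ Sym2.mem_mk_left _ _)
      have hb : b ≠ l := fun h => hle _ he (h ▸ Sym2.mem_mk_right _ _)
      rw [harcne _ he, hposne a ha, hposne b hb]
      exact (hzA _ he).2.1 a b rfl
    · rw [he, Function.update_self]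
      rcases Sym2.eq_iff.1 he with ⟨rfl, rfl⟩ | ⟨rfl, rfl⟩
      · rw [Function.update_self, hposne _ hlv.symm]
        exact (isArc_segment hqv).symm
      · rw [Function.update_self, hposne _ hlv.symm]
        exact isArc_segment hqv
  · intro e he w hw
    rcases hedge e he with he | rfl
    · rw [harcne e he] at hw
      by_cases hwl : w = l
      · rw [hwl, Function.update_self] at hw
        exact absurd (hold e he q hw hqseg).2.symm hqv
      · rw [hposne w hwl] at hw
        rcases (hzA e he).2.2 _ hw with ⟨-, h⟩ | ⟨hve, h⟩
        · exact hvert e he w h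
        · by_cases hwv : w = v
          · rwa [hwv]
          · exact absurd (segment_subset_closedBall ((hzA e he).1 hve).2 h) (hposD w hwv)
    · rw [Function.update_self] at hw
      by_cases hwl : w = l
      · rw [hwl]
        exact Sym2.mem_mk_left _ _
      · rw [hposne w hwl] at hw
        by_cases hwv : w = v
        · rw [hwv]
          exact Sym2.mem_mk_right _ _
        · exact absurd (hsegD (hsub hw)) (hposD w hwv)
  · intro e he f hf hef p hpe hpf
    rcases hedge e he with he | rfl <;> rcases hedge f hf with hf | rfl
    · rw [harcne e he] at hpe
      rw [harcne f hf] at hpf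
      rcases (hzA e he).2.2 p hpe with ⟨hD, h1⟩ | ⟨hve, h1⟩ <;>
        rcases (hzA f hf).2.2 p hpf with ⟨hD', h2⟩ | ⟨hvf, h2⟩
      · obtain ⟨w, hwe, hwf, rfl⟩ := hcross e he f hf hef p h1 h2
        exact ⟨w, hwe, hwf, (hposne w fun h => hle e he (h ▸ hwe)).symm⟩
      · exact absurd (segment_subset_closedBall ((hzA f hf).1 hvf).2 h2) hD
      · exact absurd (segment_subset_closedBall ((hzA e he).1 hve).2 h1) hD'
      · refine ⟨v, hve, hvf, ?_⟩
        rw [hposne v hlv.symm]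
        exact eq_center_of_mem_segment ((hzA e he).1 hve).2 ((hzA f hf).1 hvf).2
          (hzne e he f hf hve hvf hef) h1 h2
    · rw [harcne e he] at hpe
      rw [Function.update_self] at hpf
      obtain ⟨hve, hp⟩ := hold e he p hpe (hsub hpf)
      exact ⟨v, hve, Sym2.mem_mk_right _ _, by rw [hposne v hlv.symm, hp]⟩
    · rw [harcne f hf] at hpf
      rw [Function.update_self] at hpe
      obtain ⟨hvf, hp⟩ := hold f hf p hpf (hsub hpe)
      exact ⟨v, Sym2.mem_mk_right _ _, hvf, by rw [hposne v hlv.symm, hp]⟩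
    · exact absurd rfl hef

/-! ### Planarity and the core -/

/-- Planarity only depends on the subgraphs without leaves. -/
theorem isPlanar_of_forall_le {V : Type} [Finite V] (G : SimpleGraph V)
    (h : ∀ K ≤ G, (∀ v, (K.neighborSet v).encard ≠ 1) → IsPlanar K) : IsPlanar G := by
  -- Induction along strict inclusion of graphs: deleting a pendant edge isolates its leaf, and
  -- `IsPlanar.sup_edge` restores the edge.
  induction G using WellFoundedLT.induction with | ind G ih
  by_cases hG : ∀ v, (G.neighborSet v).encard ≠ 1
  · exact h G le_rfl hG
  push Not at hG
  obtain ⟨l, hl⟩ := hG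
  obtain ⟨v, hv⟩ := Set.encard_eq_one.1 hl
  have hadj : ∀ u, G.Adj l u ↔ u = v := fun u => Set.ext_iff.1 hv u
  have hlv : G.Adj l v := (hadj v).2 rfl
  have hdel : ∀ a b, (G.deleteEdges {s(l, v)}).Adj a b ↔ G.Adj a b ∧ s(a, b) ≠ s(l, v) := by
    intro a b
    rw [SimpleGraph.deleteEdges_adj, Set.mem_singleton_iff]
  have hlt : G.deleteEdges {s(l, v)} < G := by
    refine lt_of_le_of_ne (SimpleGraph.deleteEdges_le _) fun h => ?_
    have h' := congrArg (fun K : SimpleGraph V => K.Adj l v) h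
    exact ((hdel l v).1 (h'.mpr hlv)).2 rfl
  have hplanar := ih _ hlt fun K hK => h K (hK.trans hlt.le)
  have hiso : ∀ u, ¬ (G.deleteEdges {s(l, v)}).Adj l u := by
    intro u hu
    obtain ⟨h1, h2⟩ := (hdel l u).1 hu
    exact h2 (by rw [(hadj u).1 h1])
  have hsup := hplanar.sup_edge hlv.ne hiso
  refine hsup.of_hom_injective (SimpleGraph.Hom.ofLE ?_) Function.injective_id
  intro a b hab
  by_cases he : s(a, b) = s(l, v)
  · exact .inr ((SimpleGraph.adj_edge _ _).2 ⟨he.symm, hab.ne⟩)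
  · exact .inl ((hdel a b).2 ⟨hab, he⟩)

/-- Restricted to its support, `K` has no vertex of degree 0 or 1, so it is one of the subgraphs of
which the core is the greatest. -/
theorem le_spanningCoe_core {V : Type} {G K : SimpleGraph V} (hKG : K ≤ G)
    (hK : ∀ v, (K.neighborSet v).encard ≠ 1) : K ≤ (core G).spanningCoe := by
  let S : G.Subgraph :=
    { verts := K.support
      Adj := K.Adj
      adj_sub := fun h => hKG h
      edge_vert := fun {a b} h => ⟨b, h⟩
      symm := ⟨fun _ _ h => h.symm⟩ }
  have hS : MinDegTwo S.coe := by
    rintro ⟨v, hv⟩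
    have himg : (Subtype.val '' S.coe.neighborSet ⟨v, hv⟩ : Set V) = K.neighborSet v := by
      ext u
      constructor
      · rintro ⟨w, hw, rfl⟩
        exact hw
      · intro hu
        exact ⟨⟨u, ⟨v, SimpleGraph.Adj.symm hu⟩⟩, hu, rfl⟩
    rw [← Subtype.val_injective.encard_image, himg]
    obtain ⟨w, hw⟩ := hv
    have h0 : (K.neighborSet v).encard ≠ 0 := by
      rw [Set.encard_ne_zero]
      exact ⟨w, hw⟩
    exact Order.add_one_le_of_lt (lt_of_le_of_ne (Order.one_le_iff_ne_zero.2 h0) (hK v).symm)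
  exact fun a b hab => ((core_isGreatest G).2 hS).2 hab

theorem isPlanar_iff_core {V : Type} [Finite V] (G : SimpleGraph V) :
    IsPlanar G ↔ IsPlanar (core G).coe := by
  constructor
  · exact fun h => h.of_hom_injective (core G).hom SimpleGraph.Subgraph.hom_injective
  · intro h
    have hmap := h.map (Function.Embedding.subtype (· ∈ (core G).verts))
    refine isPlanar_of_forall_le G fun K hKG hK => ?_
    refine hmap.of_hom_injective (SimpleGraph.Hom.ofLE ?_) Function.injective_id
    intro a b hab
    have hc : (core G).Adj a b := le_spanningCoe_core hKG hK hab
    exact ⟨hab.ne, ⟨a, hc.fst_mem⟩, ⟨b, hc.snd_mem⟩, hc, rfl, rfl⟩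

theorem GraphClass.planar_coreClosed : GraphClass.planar.CoreClosed := by
  intro V _ G _
  change IsPlanar G ↔ _ ∨ IsPlanar (core G).coe
  rw [isPlanar_iff_core]
  refine ⟨.inr, fun h => h.elim (fun h => ?_) id⟩
  -- The graph without vertices is planar vacuously, so the empty-core alternative adds nothing.
  have : IsEmpty (core G).verts := by
    rw [h]
    exact Set.isEmpty_coe_sort.2 rfl
  exact ⟨fun _ => 0, fun _ => ∅, fun v => isEmptyElim v, fun v => isEmptyElim v,
    fun _ _ w => isEmptyElim w, fun e => e.ind fun a => isEmptyElim a⟩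

end CoreEnum

end

theorem mainTheorem9 :
    (∀ 𝒢 : CoreEnum.GraphClass, 𝒢.CoreClosed →
      -- decomposition into the core and the attached rooted trees: `C(z) = H(T(z)) + U(z)`
      𝒢.C = 𝒢.H.subst CoreEnum.rootedTrees + CoreEnum.unrootedTrees ∧
      -- `H(x) = C(x e^{-x}) - x + x² / 2`
      𝒢.H = 𝒢.C.subst CoreEnum.xExpNeg - PowerSeries.X
        + (1 / 2 : ℚ) • (PowerSeries.X : PowerSeries ℚ) ^ 2 ∧
      -- `H(x, y) = C(x e^{-x y}, y) - x + x² y / 2`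
      𝒢.H₂ = 𝒢.C₂.subst ![CoreEnum.xExpNegXY, MvPowerSeries.X 1] - MvPowerSeries.X 0
        + (1 / 2 : ℚ) • ((MvPowerSeries.X 0 : MvPowerSeries (Fin 2) ℚ) ^ 2
          * MvPowerSeries.X 1)) ∧
    -- the class of all graphs and the class of planar graphs are instances
    CoreEnum.GraphClass.all.CoreClosed ∧
    CoreEnum.GraphClass.planar.CoreClosed :=
  ⟨fun _ h𝒢 => ⟨h𝒢.C_eq, h𝒢.H_eq, h𝒢.H₂_eq⟩, CoreEnum.GraphClass.all_coreClosed,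
    CoreEnum.GraphClass.planar_coreClosed⟩
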